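/- Let $\ell\le k\le m\le n$ be positive integers, write $[n]=\{1,\dots,n\}$ and $\binom{[n]}{j}=\{A\subseteq[n]:|A|=j\}$, and let $\mathcal F\subseteq\binom{[n]}{k}$ and $\mathcal G\subseteq\binom{[n]}{m}$ be families whose cross intersections forbid $\ell$, that is, $|A\cap B|\ne\ell$ for every $A\in\mathcal F$ and every $B\in\mathcal G$. (i) If $k\le\frac n2$ and $m\le n-k$, then, setting $t:=\min\{\ell,k-\ell\}$, we have $$\frac{|\mathcal F|}{\binom nk}\cdot\frac{|\mathcal G|}{\binom nm}\le 50\,\sqrt{\frac{k(n-k)m(n-m)}{n^2}}\;\exp\Big(-\frac{t^2}{58^2\,k}\Big).$$ (ii) If $k\le\frac n2\le n-k<m\le n-k+\ell$, then, setting $\bar t:=\min\{k-\ell,\,n-m-(k-\ell)\}$, we have $$\frac{|\mathcal F|}{\binom nk}\cdot\frac{|\mathcal G|}{\binom nm}\le 50\,\sqrt{\frac{k(n-k)m(n-m)}{n^2}}\;\exp\Big(-\frac{\bar t^{\,2}}{58^2\,(n-m)}\Big),$$ where for $m=n$ (which forces $k=\ell$ and $\bar t=0$) the exponent $0/0$ is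 read as $0$, so that the right-hand side is $0$. -/

import Mathlib

/-- `Forbid n L F G`: the cross intersections of the families `F`, `G` of subsets of an
`n`-element set forbid `L`, that is, `|A ∩ B| ∉ L` for all `A ∈ F` and `B ∈ G`. -/
def Forbid (n : ℕ) (L : Set ℕ) (F G : Finset (Finset (Fin n))) : Prop :=
  ∀ A ∈ F, ∀ B ∈ G, (A ∩ B).card ∉ L

/-!
Work with the `p`-biased measures `μ_p` of set families. If the sizes of the cross intersections of
`𝒜` and `ℬ` avoid a window `[a, b]`, then `μ_p(𝒜) μ_q(ℬ)` is at most
`exp (κ a) (1 - κ p + O(κ² p)) ^ n + exp (-κ b) (1 + O(κ² p)) ^ n`, by induction on the ground set: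
split both families into their sections at an element `i`. The section of `ℬ` avoiding `i` is paired
with the union of the two sections of `𝒜`; the section of `ℬ` containing `i` is paired with either
section of `𝒜`, the window shifting down by one for the section containing `i`, or with their
intersection, for which the window widens to `[a - 1, b]`. If the two sections of `𝒜` are nearly
equal, then their intersection is nearly all of `𝒜` and the widening gains the factor `exp (-κ)`;
otherwise the union is much larger than `𝒜` or the sections have different measures, and that gains
instead.

For the window `[ℓ, ℓ]` and the biases `k / n` and `m / n` the best `κ` is of order `t / k`. By
Stirling's formula, passing from the uniform density of a family of `k`-sets to its measure
`μ_{k / n}` costs a factor `O(√(k (n - k) / n))`. When `m + k` exceeds `n`, replacing the members of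
`ℬ` by their complements turns `ℓ` into `k - ℓ` and `m` into `n - m`.
-/

open Finset Real
open scoped Nat FinsetFamily

section OneCoordinate

variable {p q κ A B H x₀ x₁ U I : ℝ}

lemma inv_le_one_sub_add_two_mul_sq {y : ℝ} (hy : 1 / 2 ≤ y) :
    y⁻¹ ≤ 1 - (y - 1) + 2 * (y - 1) ^ 2 := by
  rw [inv_le_iff_one_le_mul₀ (by linarith)]
  have : 0 ≤ (y - 1) ^ 2 * (2 * y - 1) := mul_nonneg (sq_nonneg _) (by linarith)
  linarith

lemma exp_le_one_add_two_mul (hκ0 : 0 ≤ κ) (hκ : κ ≤ 1 / 2) : exp κ ≤ 1 + 2 * κ := by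
  refine (exp_bound_div_one_sub_of_interval hκ0 (by linarith)).trans ?_
  rw [div_le_iff₀ (by linarith)]
  nlinarith

lemma exp_neg_le_one_sub_add_sq (hκ0 : 0 ≤ κ) (hκ : κ ≤ 1) : exp (-κ) ≤ 1 - κ + κ ^ 2 := by
  have := (abs_le.1 (abs_exp_sub_one_sub_id_le (x := -κ) (by rwa [abs_neg, abs_of_nonneg hκ0]))).2
  linarith [neg_sq κ]

/-- The coefficients sum to one, so moving weight from `U⁻¹` to the larger `x₀⁻¹` makes `q = 1 - p`
the worst case. -/
lemma inv_combination_le (hpq : q ≤ 1 - p) (hx₀ : 0 < x₀) (hU : x₀ ≤ U) :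
    (1 - q) * U⁻¹ + q * x₀⁻¹ ≤ p * U⁻¹ + (1 - p) * x₀⁻¹ := by
  have : 0 ≤ (1 - p - q) * (x₀⁻¹ - U⁻¹) :=
    mul_nonneg (by linarith) (sub_nonneg.2 (inv_anti₀ hx₀ hU))
  linarith

lemma le_of_mul_le_of_one_add_two_mul_le {y : ℝ} (hκ0 : 0 ≤ κ) (hκ : κ ≤ 1 / 2) (hA : 0 ≤ A)
    (hB : 0 ≤ B) (hy : 1 + 2 * κ ≤ y) (hH : H * y ≤ A + B * exp κ) : H ≤ A * (1 - κ) + B := by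
  have hA' : 1 ≤ (1 - κ) * y := by nlinarith
  have hB' : exp κ ≤ y := (exp_le_one_add_two_mul hκ0 hκ).trans hy
  refine le_of_mul_le_mul_right ?_ (by linarith : 0 < y)
  calc H * y ≤ A * 1 + B * exp κ := by rwa [mul_one]
    _ ≤ A * ((1 - κ) * y) + B * y := by gcongr
    _ = (A * (1 - κ) + B) * y := by ring

lemma inv_combination_le_one_sub (hp : 0 ≤ p) (hp2 : p ≤ 1 / 2) (hκ0 : 0 ≤ κ)
    (hκ : κ ≤ 1 / 100) (hx₀ : 1 - 4 * κ * p ≤ x₀) (hU : x₀ ≤ U)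
    (h : 1 + 2 * κ * p ≤ x₀ ∨ x₀ + 6 * κ ≤ U) :
    p * U⁻¹ + (1 - p) * x₀⁻¹ ≤ 1 - κ * p := by
  have hκp : κ * p ≤ κ * (1 / 2) := by gcongr
  have hκp0 : 0 ≤ κ * p := by positivity
  have hx₀_pos : 0 < x₀ := by linarith
  have hU_pos : 0 < U := by linarith
  suffices hmul : U * (1 - (1 - κ * p) * x₀) ≤ p * (U - x₀) by
    have : p * U⁻¹ + (1 - p) * x₀⁻¹ = (p * x₀ + (1 - p) * U) / (U * x₀) := by field_simp
    rw [this, div_le_iff₀ (by positivity)]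
    linarith
  rcases le_or_gt (1 + 2 * κ * p) x₀ with hbig | hsmall
  · have : 1 - (1 - κ * p) * x₀ ≤ 0 := by nlinarith
    calc U * (1 - (1 - κ * p) * x₀) ≤ 0 := mul_nonpos_of_nonneg_of_nonpos hU_pos.le this
      _ ≤ p * (U - x₀) := mul_nonneg hp (by linarith)
  · have hgap : x₀ + 6 * κ ≤ U := h.resolve_left hsmall.not_ge
    have hcoef : 1 - (1 - κ * p) * x₀ ≤ 5 * κ * p := by nlinarith
    have hU' : 5 * κ * U ≤ U - x₀ := by nlinarith
    calc U * (1 - (1 - κ * p) * x₀) ≤ U * (5 * κ * p) := by gcongr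
      _ = p * (5 * κ * U) := by ring
      _ ≤ p * (U - x₀) := by gcongr

lemma inv_combination_le_one_add (hp : 0 ≤ p) (hp2 : p ≤ 1 / 2) (hκ0 : 0 ≤ κ)
    (hκ : κ ≤ 1 / 100) (havg : (1 - p) * x₀ + p * x₁ = 1) (hUI : U + I = x₀ + x₁)
    (hx₀ : |x₀ - 1| ≤ 4 * κ * p) (hU : |U - 1| ≤ 8 * κ) (hI : |I - 1| ≤ 8 * κ) :
    p * U⁻¹ + (1 - 2 * p) * x₀⁻¹ + p * I⁻¹ ≤ 1 + 272 * κ ^ 2 * p := by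
  have hκp : κ * p ≤ κ * (1 / 2) := by gcongr
  have hinv {y : ℝ} (hy : |y - 1| ≤ 8 * κ) : y⁻¹ ≤ 1 - (y - 1) + 2 * (y - 1) ^ 2 :=
    inv_le_one_sub_add_two_mul_sq (by linarith [(abs_le.1 hy).1])
  have hU2 : (U - 1) ^ 2 ≤ (8 * κ) ^ 2 := sq_le_sq.2 (hU.trans (le_abs_self _))
  have hI2 : (I - 1) ^ 2 ≤ (8 * κ) ^ 2 := sq_le_sq.2 (hI.trans (le_abs_self _))
  have hx₀2 : (x₀ - 1) ^ 2 ≤ 8 * κ ^ 2 * p :=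
    calc (x₀ - 1) ^ 2 ≤ (4 * κ * p) ^ 2 := sq_le_sq.2 (hx₀.trans (le_abs_self _))
      _ = 16 * κ ^ 2 * p * p := by ring
      _ ≤ 16 * κ ^ 2 * p * (1 / 2) := by gcongr
      _ = 8 * κ ^ 2 * p := by ring
  have hfirst : p * (U - 1) + (1 - 2 * p) * (x₀ - 1) + p * (I - 1) = 0 := by
    linear_combination havg + p * hUI
  have h2p : 0 ≤ 1 - 2 * p := by linarith
  calc p * U⁻¹ + (1 - 2 * p) * x₀⁻¹ + p * I⁻¹
      ≤ p * (1 - (U - 1) + 2 * (8 * κ) ^ 2) +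
          (1 - 2 * p) * (1 - (x₀ - 1) + 2 * (8 * κ ^ 2 * p)) +
          p * (1 - (I - 1) + 2 * (8 * κ) ^ 2) := by
        gcongr
        · exact (hinv hU).trans (by gcongr)
        · exact (hinv (by linarith)).trans (by gcongr)
        · exact (hinv hI).trans (by gcongr)
    _ = 1 + 272 * κ ^ 2 * p - 32 * κ ^ 2 * p * p := by linear_combination -hfirst
    _ ≤ 1 + 272 * κ ^ 2 * p := sub_le_self _ (by positivity)

lemma le_mul_inv_of_mul_le {y C : ℝ} (hy : 0 < y) (h : H * y ≤ C) : H ≤ C * y⁻¹ := by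
  rwa [← div_eq_mul_inv, le_div_iff₀ hy]

lemma weighted_sections_le_of_balanced {H₀ H₁ : ℝ} (hp : 0 ≤ p) (hp2 : p ≤ 1 / 2) (hpq : p ≤ q)
    (hq : q ≤ 1 - p) (hκ0 : 0 ≤ κ) (hκ : κ ≤ 1 / 100) (hA : 0 ≤ A) (hB : 0 ≤ B)
    (havg : (1 - p) * x₀ + p * x₁ = 1) (hUI : U + I = x₀ + x₁) (hx₀U : x₀ ≤ U) (hI_le : I ≤ 1)
    (hx₀ : |x₀ - 1| ≤ 4 * κ * p) (hU : |U - 1| ≤ 8 * κ) (hI : |I - 1| ≤ 8 * κ)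
    (h₀ : H₀ * U ≤ A + B) (h₁ : H₁ * x₀ ≤ A + B) (h₃ : H₁ * I ≤ A * exp (-κ) + B) :
    (1 - q) * H₀ + q * H₁ ≤
      A * (1 - κ * p + 300 * κ ^ 2 * p) + B * (1 + 300 * κ ^ 2 * p) := by
  have hκp : 4 * κ * p ≤ 4 * κ * (1 / 2) := by gcongr
  have hx₀_pos : 0 < x₀ := by linarith [(abs_le.1 hx₀).1]
  have hU_pos : 0 < U := by linarith [(abs_le.1 hU).1]
  have hI_pos : 0 < I := by linarith [(abs_le.1 hI).1]
  have hI_inv : 1 ≤ I⁻¹ := (one_le_inv₀ hI_pos).2 hI_le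
  have hgain : (A * exp (-κ) + B) * I⁻¹ ≤ (A + B) * I⁻¹ - A * (κ - κ ^ 2) :=
    calc (A * exp (-κ) + B) * I⁻¹ ≤ (A * (1 - κ + κ ^ 2) + B) * I⁻¹ := by
          gcongr; exact exp_neg_le_one_sub_add_sq hκ0 (by linarith)
      _ = (A + B) * I⁻¹ - A * (κ - κ ^ 2) * I⁻¹ := by ring
      _ ≤ (A + B) * I⁻¹ - A * (κ - κ ^ 2) := by
          have := le_mul_of_one_le_right (mul_nonneg hA (by nlinarith : 0 ≤ κ - κ ^ 2)) hI_inv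
          linarith
  calc (1 - q) * H₀ + q * H₁ = (1 - q) * H₀ + (q - p) * H₁ + p * H₁ := by ring
    _ ≤ (1 - q) * ((A + B) * U⁻¹) + (q - p) * ((A + B) * x₀⁻¹) +
          p * ((A + B) * I⁻¹ - A * (κ - κ ^ 2)) := by
        gcongr
        · linarith
        · exact le_mul_inv_of_mul_le hU_pos h₀
        · exact le_mul_inv_of_mul_le hx₀_pos h₁
        · exact (le_mul_inv_of_mul_le hI_pos h₃).trans hgain
    _ = (A + B) * ((1 - q) * U⁻¹ + q * x₀⁻¹ - p * x₀⁻¹ + p * I⁻¹) - A * (κ * p - κ ^ 2 * p) := by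
        ring
    _ ≤ (A + B) * (1 + 272 * κ ^ 2 * p) - A * (κ * p - κ ^ 2 * p) := by
        refine sub_le_sub_right (mul_le_mul_of_nonneg_left ?_ (add_nonneg hA hB)) _
        linarith [inv_combination_le_one_add hp hp2 hκ0 hκ havg hUI hx₀ hU hI,
          inv_combination_le hq hx₀_pos hx₀U]
    _ ≤ A * (1 - κ * p + 300 * κ ^ 2 * p) + B * (1 + 300 * κ ^ 2 * p) := by
        have : 0 ≤ A * (κ ^ 2 * p) := by positivity
        have : 0 ≤ B * (κ ^ 2 * p) := by positivity
        linarith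

lemma weighted_sections_le_of_unbalanced {H₀ H₁ : ℝ} (hp : 0 ≤ p) (hp2 : p ≤ 1 / 2) (hpq : p ≤ q)
    (hq : q ≤ 1 - p) (hκ0 : 0 ≤ κ) (hκ : κ ≤ 1 / 100) (hAB : 0 ≤ A + B)
    (hx₀ : 1 - 4 * κ * p ≤ x₀) (hU : x₀ ≤ U) (h : 1 + 2 * κ * p ≤ x₀ ∨ x₀ + 6 * κ ≤ U)
    (h₀ : H₀ * U ≤ A + B) (h₁ : H₁ * x₀ ≤ A + B) :
    (1 - q) * H₀ + q * H₁ ≤ (A + B) * (1 - κ * p) := by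
  have hκp : 4 * κ * p ≤ 4 * κ * (1 / 2) := by gcongr
  have hx₀_pos : 0 < x₀ := by linarith
  calc (1 - q) * H₀ + q * H₁ ≤ (1 - q) * ((A + B) * U⁻¹) + q * ((A + B) * x₀⁻¹) := by
        gcongr
        · linarith
        · exact le_mul_inv_of_mul_le (hx₀_pos.trans_le hU) h₀
        · linarith
        · exact le_mul_inv_of_mul_le hx₀_pos h₁
    _ = (A + B) * ((1 - q) * U⁻¹ + q * x₀⁻¹) := by ring
    _ ≤ (A + B) * (1 - κ * p) := by
        gcongr
        exact (inv_combination_le hq hx₀_pos hU).trans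
          (inv_combination_le_one_sub hp hp2 hκ0 hκ hx₀ hU h)

lemma weighted_sections_le_of_one_add_two_mul_le {H₀ H₁ : ℝ} (hq0 : 0 ≤ q) (hq1 : q ≤ 1)
    (hκ0 : 0 ≤ κ) (hκ : κ ≤ 1 / 2) (hA : 0 ≤ A) (hB : 0 ≤ B) (hx₁ : 1 + 2 * κ ≤ x₁) (hU : x₁ ≤ U)
    (h₀ : H₀ * U ≤ A + B) (h₂ : H₁ * x₁ ≤ A * exp (-κ) + B * exp κ) :
    (1 - q) * H₀ + q * H₁ ≤ A * (1 - κ) + B := by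
  have hH₀ : H₀ ≤ A * (1 - κ) + B :=
    le_of_mul_le_of_one_add_two_mul_le hκ0 hκ hA hB (hx₁.trans hU)
      (h₀.trans (add_le_add_right (le_mul_of_one_le_right hB (one_le_exp hκ0)) A))
  have hH₁ : H₁ ≤ A * (1 - κ) + B :=
    le_of_mul_le_of_one_add_two_mul_le hκ0 hκ hA hB hx₁
      (h₂.trans (add_le_add_left
        (mul_le_of_le_one_right hA (exp_le_one_iff.2 (neg_nonpos.2 hκ0))) _))
  calc (1 - q) * H₀ + q * H₁ ≤ (1 - q) * (A * (1 - κ) + B) + q * (A * (1 - κ) + B) := by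
        gcongr
    _ = A * (1 - κ) + B := by ring

/-- Relative to the measure `v` of the first family, `x₀`, `x₁`, `U` and `I` are the measures of its
two sections and of their union and intersection, while `H₀` and `H₁` are `v` times the measures of
the sections of the second family. The bounds `h₀`, `h₁`, `h₂`, `h₃` come from, respectively,
uniting the two sections of the first family, ignoring one of them, shifting the window of forbidden
sizes, and widening it. -/
lemma weighted_sections_le {H₀ H₁ : ℝ} (hp : 0 ≤ p) (hp2 : p ≤ 1 / 2) (hpq : p ≤ q)
    (hq : q ≤ 1 - p) (hκ0 : 0 ≤ κ) (hκ : κ ≤ 1 / 100) (hA : 0 ≤ A) (hB : 0 ≤ B)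
    (havg : (1 - p) * x₀ + p * x₁ = 1) (hUI : U + I = x₀ + x₁) (hI₀ : I ≤ x₀) (hI₁ : I ≤ x₁)
    (h₀ : H₀ * U ≤ A + B) (h₁ : H₁ * x₀ ≤ A + B)
    (h₂ : H₁ * x₁ ≤ A * exp (-κ) + B * exp κ) (h₃ : H₁ * I ≤ A * exp (-κ) + B) :
    (1 - q) * H₀ + q * H₁ ≤
      A * (1 - κ * p + 300 * κ ^ 2 * p) + B * (1 + 300 * κ ^ 2 * p) := by
  have hκp : 0 ≤ κ * p := by positivity
  have hAκ : 0 ≤ A * (κ ^ 2 * p) := by positivity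
  have hBκ : 0 ≤ B * (κ ^ 2 * p) := by positivity
  have hx₀U : x₀ ≤ U := by linarith
  rcases le_or_gt (1 + 2 * κ) x₁ with hx₁ | hx₁
  · have := weighted_sections_le_of_one_add_two_mul_le (hp.trans hpq) (by linarith) hκ0
      (by linarith) hA hB hx₁ (by linarith : x₁ ≤ U) h₀ h₂
    have : A * (κ * p) ≤ A * (κ * 1) := by gcongr; linarith
    linarith
  have hx₀_low : 1 - 4 * κ * p ≤ x₀ := by nlinarith
  by_cases hunb : 1 + 2 * κ * p ≤ x₀ ∨ x₀ + 6 * κ ≤ U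
  · have := weighted_sections_le_of_unbalanced hp hp2 hpq hq hκ0 hκ (add_nonneg hA hB) hx₀_low
      hx₀U hunb h₀ h₁
    have : 0 ≤ B * (κ * p) := by positivity
    linarith
  obtain ⟨hx₀_up, hU_up⟩ := not_or.1 hunb
  rw [not_le] at hx₀_up hU_up
  have hx₁_low : 1 - 2 * κ ≤ x₁ := by
    by_contra! hx₁_lt
    nlinarith
  have hU_low : 1 ≤ U := by nlinarith
  have hI_up : I ≤ 1 := by nlinarith
  have hκp2 : κ * p ≤ κ * (1 / 2) := by gcongr
  refine weighted_sections_le_of_balanced hp hp2 hpq hq hκ0 hκ hA hB havg hUI hx₀U hI_up ?_ ?_ ?_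
    h₀ h₁ h₃ <;> exact abs_le.2 ⟨by linarith, by linarith⟩

end OneCoordinate

section BiasedWeight

variable {α : Type*} [DecidableEq α] {p : ℝ} {s : Finset α} {i : α} {𝒜 ℬ : Finset (Finset α)}

/-- The `p`-biased measure of a family `𝒜` of subsets of the ground set `s`: the probability that
`A ∈ 𝒜` for a random subset `A` of `s` containing each element independently with
probability `p`. -/
noncomputable def biasedWeight (p : ℝ) (s : Finset α) (𝒜 : Finset (Finset α)) : ℝ :=
  ∑ A ∈ 𝒜, p ^ #A * (1 - p) ^ #(s \ A)

lemma biasedWeight_nonneg (hp0 : 0 ≤ p) (hp1 : p ≤ 1) : 0 ≤ biasedWeight p s 𝒜 :=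
  have := sub_nonneg.2 hp1
  sum_nonneg fun A _ => by positivity

lemma biasedWeight_mono (hp0 : 0 ≤ p) (hp1 : p ≤ 1) (h : 𝒜 ⊆ ℬ) :
    biasedWeight p s 𝒜 ≤ biasedWeight p s ℬ :=
  have := sub_nonneg.2 hp1
  sum_le_sum_of_subset_of_nonneg h fun A _ _ => by positivity

lemma biasedWeight_union_add_inter (p : ℝ) (s : Finset α) (𝒜 ℬ : Finset (Finset α)) :
    biasedWeight p s (𝒜 ∪ ℬ) + biasedWeight p s (𝒜 ∩ ℬ) =
      biasedWeight p s 𝒜 + biasedWeight p s ℬ :=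
  sum_union_inter

lemma biasedWeight_empty_le_one (h𝒜 : 𝒜 ⊆ powerset ∅) : biasedWeight p ∅ 𝒜 ≤ 1 := by
  rcases subset_singleton_iff.1 h𝒜 with rfl | rfl <;> simp [biasedWeight]

lemma nonMemberSubfamily_subset_powerset (h𝒜 : 𝒜 ⊆ (insert i s).powerset) :
    𝒜.nonMemberSubfamily i ⊆ s.powerset := by
  intro A hA
  obtain ⟨hA𝒜, hiA⟩ := mem_nonMemberSubfamily.1 hA
  exact mem_powerset.2 ((subset_insert_iff_of_notMem hiA).1 (mem_powerset.1 (h𝒜 hA𝒜)))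

lemma memberSubfamily_subset_powerset (h𝒜 : 𝒜 ⊆ (insert i s).powerset) :
    𝒜.memberSubfamily i ⊆ s.powerset := by
  intro A hA
  obtain ⟨hA𝒜, hiA⟩ := mem_memberSubfamily.1 hA
  exact mem_powerset.2 ((insert_subset_insert_iff hiA).1 (mem_powerset.1 (h𝒜 hA𝒜)))

lemma biasedWeight_insert (p : ℝ) (hi : i ∉ s) (𝒜 : Finset (Finset α)) :
    biasedWeight p (insert i s) 𝒜 = (1 - p) * biasedWeight p s (𝒜.nonMemberSubfamily i) +
      p * biasedWeight p s (𝒜.memberSubfamily i) := by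
  have hmem : ∑ A ∈ 𝒜 with i ∈ A, p ^ #A * (1 - p) ^ #(insert i s \ A) =
      p * biasedWeight p s (𝒜.memberSubfamily i) := by
    rw [← image_insert_memberSubfamily, sum_image, biasedWeight, mul_sum]
    · refine sum_congr rfl fun A hA => ?_
      have hiA : i ∉ A := (mem_memberSubfamily.1 hA).2
      rw [card_insert_of_notMem hiA, insert_sdiff_insert, sdiff_insert_of_notMem hi]
      ring
    · intro A hA B hB hAB
      rw [← erase_insert (mem_memberSubfamily.1 hA).2, hAB,
        erase_insert (mem_memberSubfamily.1 hB).2]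
  have hnon : ∑ A ∈ 𝒜 with i ∉ A, p ^ #A * (1 - p) ^ #(insert i s \ A) =
      (1 - p) * biasedWeight p s (𝒜.nonMemberSubfamily i) := by
    rw [biasedWeight, mul_sum]
    refine sum_congr rfl fun A hA => ?_
    have hiA : i ∉ A := (mem_filter.1 hA).2
    rw [insert_sdiff_of_notMem _ hiA, card_insert_of_notMem fun h => hi (mem_sdiff.1 h).1]
    ring
  rw [← hmem, ← hnon, add_comm]
  exact (sum_filter_add_sum_filter_not 𝒜 (i ∈ ·) _).symm

lemma biasedWeight_of_sized {k : ℕ} (p : ℝ) (h𝒜s : 𝒜 ⊆ s.powerset)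
    (h𝒜 : (𝒜 : Set (Finset α)).Sized k) :
    biasedWeight p s 𝒜 = #𝒜 * (p ^ k * (1 - p) ^ (#s - k)) := by
  rw [← nsmul_eq_mul, ← sum_const]
  refine sum_congr rfl fun A hA => ?_
  rw [card_sdiff_of_subset (mem_powerset.1 (h𝒜s hA)), h𝒜 hA]

end BiasedWeight

section CrossAvoids

variable {α : Type*} [DecidableEq α] {a b : ℤ} {i : α} {𝒜 ℬ : Finset (Finset α)}

/-- No member of `𝒜` meets a member of `ℬ` in a number of elements from the window `[a, b]`. The
window is made of integers so that it may be shifted below zero. -/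
def CrossAvoids (a b : ℤ) (𝒜 ℬ : Finset (Finset α)) : Prop :=
  ∀ ⦃A⦄, A ∈ 𝒜 → ∀ ⦃B⦄, B ∈ ℬ → (#(A ∩ B) : ℤ) ∉ Set.Icc a b

lemma crossAvoids_self_of_card_inter_ne {ℓ : ℕ} (h : ∀ A ∈ 𝒜, ∀ B ∈ ℬ, #(A ∩ B) ≠ ℓ) :
    CrossAvoids ℓ ℓ 𝒜 ℬ := by
  intro A hA B hB hAB
  rw [Set.Icc_self, Set.mem_singleton_iff, Nat.cast_inj] at hAB
  exact h A hA B hB hAB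

lemma card_mul_card_eq_zero_of_sized_zero (h𝒜 : (𝒜 : Set (Finset α)).Sized 0)
    (h : ∀ A ∈ 𝒜, ∀ B ∈ ℬ, #(A ∩ B) ≠ 0) : #𝒜 * #ℬ = 0 := by
  rw [← card_product, card_eq_zero, eq_empty_iff_forall_notMem]
  rintro ⟨A, B⟩ hAB
  obtain ⟨hA, hB⟩ : A ∈ 𝒜 ∧ B ∈ ℬ := mem_product.1 hAB
  exact h A hA B hB (by rw [card_eq_zero.1 (h𝒜 hA), empty_inter, card_empty])

lemma CrossAvoids.union_nonMember (h : CrossAvoids a b 𝒜 ℬ) :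
    CrossAvoids a b (𝒜.nonMemberSubfamily i ∪ 𝒜.memberSubfamily i) (ℬ.nonMemberSubfamily i) := by
  intro A hA B hB
  obtain ⟨hBℬ, hiB⟩ := mem_nonMemberSubfamily.1 hB
  rcases mem_union.1 hA with hA | hA
  · exact h (mem_nonMemberSubfamily.1 hA).1 hBℬ
  · rw [← insert_inter_of_notMem hiB]
    exact h (mem_memberSubfamily.1 hA).1 hBℬ

lemma CrossAvoids.nonMember_member (h : CrossAvoids a b 𝒜 ℬ) :
    CrossAvoids a b (𝒜.nonMemberSubfamily i) (ℬ.memberSubfamily i) := by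
  intro A hA B hB
  obtain ⟨hA𝒜, hiA⟩ := mem_nonMemberSubfamily.1 hA
  rw [← inter_insert_of_notMem hiA]
  exact h hA𝒜 (mem_memberSubfamily.1 hB).1

lemma CrossAvoids.member_member (h : CrossAvoids a b 𝒜 ℬ) :
    CrossAvoids (a - 1) (b - 1) (𝒜.memberSubfamily i) (ℬ.memberSubfamily i) := by
  intro A hA B hB hAB
  obtain ⟨hA𝒜, hiA⟩ := mem_memberSubfamily.1 hA
  refine h hA𝒜 (mem_memberSubfamily.1 hB).1 ?_
  rw [← insert_inter_distrib, card_insert_of_notMem fun hi => hiA (mem_inter.1 hi).1]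
  rw [Set.mem_Icc] at hAB ⊢
  lia

lemma CrossAvoids.inter_member (hab : a ≤ b) (h : CrossAvoids a b 𝒜 ℬ) :
    CrossAvoids (a - 1) b (𝒜.nonMemberSubfamily i ∩ 𝒜.memberSubfamily i)
      (ℬ.memberSubfamily i) := by
  intro A hA B hB hAB
  have hkeep := h.nonMember_member (mem_inter.1 hA).1 hB
  have hshift := h.member_member (mem_inter.1 hA).2 hB
  rw [Set.mem_Icc] at hAB hkeep hshift
  lia

end CrossAvoids

section CrossAvoidsBound

variable {α : Type*} [DecidableEq α] {p q κ : ℝ} {a b : ℤ} {s : Finset α}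
  {𝒜 ℬ : Finset (Finset α)}

lemma CrossAvoids.pos_or_neg (h : CrossAvoids a b 𝒜 ℬ) (h𝒜 : 𝒜 ⊆ powerset ∅)
    (h𝒜_ne : 𝒜.Nonempty) (hℬ_ne : ℬ.Nonempty) : 0 < a ∨ b < 0 := by
  obtain ⟨A, hA⟩ := h𝒜_ne
  obtain ⟨B, hB⟩ := hℬ_ne
  have hAB := h hA hB
  rw [subset_empty.1 (mem_powerset.1 (h𝒜 hA)), empty_inter, card_empty, Nat.cast_zero,
    Set.mem_Icc] at hAB
  lia

lemma CrossAvoids.biasedWeight_empty_mul_le (h : CrossAvoids a b 𝒜 ℬ) (hq0 : 0 ≤ q) (hq1 : q ≤ 1)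
    (hκ0 : 0 ≤ κ) (h𝒜 : 𝒜 ⊆ powerset ∅) (hℬ : ℬ ⊆ powerset ∅) :
    biasedWeight p ∅ 𝒜 * biasedWeight q ∅ ℬ ≤ exp (κ * a) + exp (-(κ * b)) := by
  rcases 𝒜.eq_empty_or_nonempty with rfl | h𝒜_ne
  · simpa [biasedWeight] using by positivity
  rcases ℬ.eq_empty_or_nonempty with rfl | hℬ_ne
  · simpa [biasedWeight] using by positivity
  have hle_one : biasedWeight p ∅ 𝒜 * biasedWeight q ∅ ℬ ≤ 1 :=
    mul_le_one₀ (biasedWeight_empty_le_one h𝒜) (biasedWeight_nonneg hq0 hq1)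
      (biasedWeight_empty_le_one hℬ)
  rcases h.pos_or_neg h𝒜 h𝒜_ne hℬ_ne with ha | hb
  · have : 1 ≤ exp (κ * a) := one_le_exp (mul_nonneg hκ0 (by exact_mod_cast ha.le))
    linarith [exp_pos (-(κ * b))]
  · have : 1 ≤ exp (-(κ * b)) :=
      one_le_exp (neg_nonneg.2 (mul_nonpos_of_nonneg_of_nonpos hκ0 (by exact_mod_cast hb.le)))
    linarith [exp_pos (κ * a)]

lemma one_sub_add_sq_nonneg (hp0 : 0 ≤ p) (hp1 : p ≤ 1) (hκ : κ ≤ 1) :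
    0 ≤ 1 - κ * p + 300 * κ ^ 2 * p := by
  have : κ * p ≤ 1 := mul_le_one₀ hκ hp0 hp1
  have : 0 ≤ 300 * κ ^ 2 * p := by positivity
  linarith

lemma biasedWeight_insert_mul_le {i : α} (hp0 : 0 ≤ p) (hp2 : p ≤ 1 / 2) (hpq : p ≤ q)
    (hq : q ≤ 1 - p) (hκ0 : 0 ≤ κ) (hκ : κ ≤ 1 / 100) {A B : ℝ} (hA : 0 ≤ A) (hB : 0 ≤ B)
    (hi : i ∉ s)
    (h₀ : biasedWeight p s (𝒜.nonMemberSubfamily i ∪ 𝒜.memberSubfamily i) *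
      biasedWeight q s (ℬ.nonMemberSubfamily i) ≤ A + B)
    (h₁ : biasedWeight p s (𝒜.nonMemberSubfamily i) * biasedWeight q s (ℬ.memberSubfamily i) ≤
      A + B)
    (h₂ : biasedWeight p s (𝒜.memberSubfamily i) * biasedWeight q s (ℬ.memberSubfamily i) ≤
      A * exp (-κ) + B * exp κ)
    (h₃ : biasedWeight p s (𝒜.nonMemberSubfamily i ∩ 𝒜.memberSubfamily i) *
      biasedWeight q s (ℬ.memberSubfamily i) ≤ A * exp (-κ) + B) :
    biasedWeight p (insert i s) 𝒜 * biasedWeight q (insert i s) ℬ ≤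
      A * (1 - κ * p + 300 * κ ^ 2 * p) + B * (1 + 300 * κ ^ 2 * p) := by
  have hp1 : p ≤ 1 := by linarith
  obtain ⟨v, hv⟩ : ∃ v, v = biasedWeight p (insert i s) 𝒜 := ⟨_, rfl⟩
  have hv0 : 0 ≤ v := hv ▸ biasedWeight_nonneg hp0 hp1
  rw [← hv]
  rcases hv0.eq_or_lt with rfl | hv_pos
  · have : 0 ≤ 1 - κ * p + 300 * κ ^ 2 * p := one_sub_add_sq_nonneg hp0 hp1 (by linarith)
    rw [zero_mul]
    positivity
  have hrescale {x y C : ℝ} (h : x * y ≤ C) : v * y * (x / v) ≤ C := by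
    rwa [mul_right_comm, mul_div_cancel₀ _ hv_pos.ne']
  have hstep := weighted_sections_le hp0 hp2 hpq hq hκ0 hκ hA hB
    (by field_simp; rw [hv, biasedWeight_insert p hi])
    (by rw [← add_div, ← add_div, biasedWeight_union_add_inter])
    (div_le_div_of_nonneg_right (biasedWeight_mono hp0 hp1 inter_subset_left) hv0)
    (div_le_div_of_nonneg_right (biasedWeight_mono hp0 hp1 inter_subset_right) hv0)
    (hrescale h₀) (hrescale h₁) (hrescale h₂) (hrescale h₃)
  rw [biasedWeight_insert q hi]
  linarith

theorem CrossAvoids.biasedWeight_mul_le (hp0 : 0 ≤ p) (hp2 : p ≤ 1 / 2) (hpq : p ≤ q)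
    (hq : q ≤ 1 - p) (hκ0 : 0 ≤ κ) (hκ : κ ≤ 1 / 100) (hab : a ≤ b) (h : CrossAvoids a b 𝒜 ℬ)
    (h𝒜 : 𝒜 ⊆ s.powerset) (hℬ : ℬ ⊆ s.powerset) :
    biasedWeight p s 𝒜 * biasedWeight q s ℬ ≤
      exp (κ * a) * (1 - κ * p + 300 * κ ^ 2 * p) ^ #s +
        exp (-(κ * b)) * (1 + 300 * κ ^ 2 * p) ^ #s := by
  set c := 1 - κ * p + 300 * κ ^ 2 * p
  set d := 1 + 300 * κ ^ 2 * p
  have hc0 : 0 ≤ c := one_sub_add_sq_nonneg hp0 (by linarith) (by linarith)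
  induction s using Finset.induction_on generalizing a b 𝒜 ℬ with
  | empty => simpa using h.biasedWeight_empty_mul_le (hp0.trans hpq) (by linarith) hκ0 h𝒜 hℬ
  | insert i s hi ih =>
    have h𝒜₀ := nonMemberSubfamily_subset_powerset h𝒜
    have h𝒜₁ := memberSubfamily_subset_powerset h𝒜
    have hℬ₀ := nonMemberSubfamily_subset_powerset hℬ
    have hℬ₁ := memberSubfamily_subset_powerset hℬ
    have h₀ := ih hab h.union_nonMember (union_subset h𝒜₀ h𝒜₁) hℬ₀
    have h₁ := ih hab h.nonMember_member h𝒜₀ hℬ₁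
    have h₂ := ih (sub_le_sub_right hab 1) h.member_member h𝒜₁ hℬ₁
    have h₃ := ih (by lia) (h.inter_member hab) (inter_subset_left.trans h𝒜₀) hℬ₁
    have hexp_a : exp (κ * (a - 1 : ℤ)) * c ^ #s = exp (κ * a) * c ^ #s * exp (-κ) := by
      rw [mul_right_comm, ← exp_add]; push_cast; ring_nf
    have hexp_b : exp (-(κ * (b - 1 : ℤ))) * d ^ #s = exp (-(κ * b)) * d ^ #s * exp κ := by
      rw [mul_right_comm, ← exp_add]; push_cast; ring_nf
    rw [hexp_a] at h₂ h₃
    rw [hexp_b] at h₂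
    rw [card_insert_of_notMem hi, pow_succ, pow_succ, ← mul_assoc, ← mul_assoc]
    exact biasedWeight_insert_mul_le hp0 hp2 hpq hq hκ0 hκ (by positivity) (by positivity) hi
      h₀ h₁ h₂ h₃

lemma one_add_pow_le_exp {x : ℝ} (hx : 0 ≤ 1 + x) (n : ℕ) : (1 + x) ^ n ≤ exp (n * x) := by
  rw [exp_nat_mul]
  gcongr
  linarith [add_one_le_exp x]

/-- The parameter `κ = t / (600 * (#s * p))` balances the linear gain `κ * t` against the quadratic
loss `300 * κ ^ 2 * (#s * p)`. -/
theorem CrossAvoids.biasedWeight_mul_le_two_mul_exp {ℓ : ℤ} {t : ℝ} (hp0 : 0 ≤ p)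
    (hp2 : p ≤ 1 / 2) (hpq : p ≤ q) (hq : q ≤ 1 - p) (ht0 : 0 ≤ t) (htℓ : t ≤ ℓ)
    (ht : t ≤ #s * p - ℓ) (h : CrossAvoids ℓ ℓ 𝒜 ℬ) (h𝒜 : 𝒜 ⊆ s.powerset)
    (hℬ : ℬ ⊆ s.powerset) :
    biasedWeight p s 𝒜 * biasedWeight q s ℬ ≤ 2 * exp (-(t ^ 2 / (1200 * (#s * p)))) := by
  set N := #s * p with hN
  have hN0 : 0 ≤ N := by positivity
  obtain ⟨κ, hκ⟩ : ∃ κ, κ = t / (600 * N) := ⟨_, rfl⟩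
  have hκ0 : 0 ≤ κ := by rw [hκ]; positivity
  have hκ_le : κ ≤ 1 / 100 := by
    rw [hκ]
    exact div_le_of_le_mul₀ (by positivity) (by norm_num) (by linarith)
  have hloss : 300 * κ ^ 2 * N = t ^ 2 / (1200 * N) := by
    rcases hN0.eq_or_lt with hN0 | hN_pos
    · simp [← hN0]
    · rw [hκ]; field_simp; ring
  have hgain : κ * t = 2 * (t ^ 2 / (1200 * N)) := by rw [hκ]; ring
  have hc0 : 0 ≤ 1 - κ * p + 300 * κ ^ 2 * p :=
    one_sub_add_sq_nonneg hp0 (by linarith) (by linarith)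
  have hκκp : 0 ≤ 300 * κ ^ 2 * p := by positivity
  calc biasedWeight p s 𝒜 * biasedWeight q s ℬ
      ≤ exp (κ * ℓ) * (1 - κ * p + 300 * κ ^ 2 * p) ^ #s +
          exp (-(κ * ℓ)) * (1 + 300 * κ ^ 2 * p) ^ #s :=
        h.biasedWeight_mul_le hp0 hp2 hpq hq hκ0 hκ_le le_rfl h𝒜 hℬ
    _ ≤ exp (κ * ℓ) * exp (#s * (-(κ * p) + 300 * κ ^ 2 * p)) +
          exp (-(κ * ℓ)) * exp (#s * (300 * κ ^ 2 * p)) := by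
        rw [sub_eq_add_neg, add_assoc]
        gcongr <;> exact one_add_pow_le_exp (by linarith) _
    _ = exp (-(κ * (N - ℓ)) + 300 * κ ^ 2 * N) + exp (-(κ * ℓ) + 300 * κ ^ 2 * N) := by
        rw [← exp_add, ← exp_add, hN]; ring_nf
    _ ≤ exp (-(κ * t) + 300 * κ ^ 2 * N) + exp (-(κ * t) + 300 * κ ^ 2 * N) := by gcongr
    _ = 2 * exp (-(t ^ 2 / (1200 * N))) := by rw [hgain, hloss]; ring_nf

end CrossAvoidsBound

section Stirling

variable {k j : ℕ}

lemma factorial_le_stirling {n : ℕ} (hn : n ≠ 0) : (n ! : ℝ) ≤ exp 1 * √n * (n / exp 1) ^ n := by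
  obtain ⟨j, rfl⟩ := Nat.exists_eq_succ_of_ne_zero hn
  have h : Stirling.stirlingSeq (j + 1) ≤ Stirling.stirlingSeq 1 :=
    Stirling.stirlingSeq'_antitone (Nat.zero_le j)
  rw [Stirling.stirlingSeq_one, Stirling.stirlingSeq, div_le_iff₀ (by positivity)] at h
  refine h.trans (le_of_eq ?_)
  rw [sqrt_mul zero_le_two]
  field_simp

lemma exp_one_sq_le_three_mul_sqrt_two_mul_pi : exp 1 ^ 2 ≤ 3 * √(2 * π) := by
  have hsq : exp 1 ^ 2 ≤ 7.39 :=
    calc exp 1 ^ 2 ≤ 2.7182818286 ^ 2 := by gcongr; exact exp_one_lt_d9.le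
      _ ≤ 7.39 := by norm_num
  have hsqrt : 2.5 ≤ √(2 * π) := le_sqrt_of_sq_le (by linarith [pi_gt_d2])
  linarith

lemma sqrt_two_pi_mul_le_choose_mul (hk : k ≠ 0) (hj : j ≠ 0) :
    √(2 * π * (k + j)) ≤ exp 1 ^ 2 * √(k * j) *
      ((k + j).choose k * ((k / (k + j) : ℝ) ^ k * (j / (k + j) : ℝ) ^ j)) := by
  set w := (k / (k + j) : ℝ) ^ k * (j / (k + j) : ℝ) ^ j with hw
  have hfactor : ((k + j) / exp 1) ^ (k + j) * w = (k / exp 1) ^ k * (j / exp 1) ^ j := by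
    rw [hw, pow_add, mul_mul_mul_comm, ← mul_pow, ← mul_pow]
    congr 2 <;> field_simp
  have hlow := Stirling.le_factorial_stirling (k + j)
  push_cast at hlow
  have hM : 0 < (k / exp 1) ^ k * (j / exp 1) ^ j := by positivity
  refine le_of_mul_le_mul_right ?_ hM
  calc √(2 * π * (k + j)) * ((k / exp 1) ^ k * (j / exp 1) ^ j)
      = √(2 * π * (k + j)) * ((k + j) / exp 1) ^ (k + j) * w := by rw [← hfactor]; ring
    _ ≤ (k + j)! * w := by gcongr
    _ = (k + j).choose k * w * (k ! * j !) := by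
        rw [← Nat.add_choose_mul_factorial_mul_factorial, Nat.choose_symm_add]; push_cast; ring
    _ ≤ (k + j).choose k * w * ((exp 1 * √k * (k / exp 1) ^ k) *
          (exp 1 * √j * (j / exp 1) ^ j)) := by
        gcongr <;> exact factorial_le_stirling ‹_›
    _ = _ := by rw [sqrt_mul k.cast_nonneg]; ring

lemma sqrt_add_le_choose_mul (hk : k ≠ 0) (hj : j ≠ 0) :
    √(k + j) ≤ 3 * √(k * j) *
      ((k + j).choose k * ((k / (k + j) : ℝ) ^ k * (j / (k + j) : ℝ) ^ j)) := by
  have hπ : 0 < √(2 * π) := by positivity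
  refine le_of_mul_le_mul_left ?_ hπ
  calc √(2 * π) * √(k + j) = √(2 * π * (k + j)) := (sqrt_mul (by positivity) _).symm
    _ ≤ exp 1 ^ 2 * √(k * j) * _ := sqrt_two_pi_mul_le_choose_mul hk hj
    _ ≤ 3 * √(2 * π) * √(k * j) * _ := by
        gcongr; exact exp_one_sq_le_three_mul_sqrt_two_mul_pi
    _ = _ := by ring

lemma one_le_choose_mul_pow_mul_pow {n : ℕ} (hk : k ≠ 0) (hkn : k < n) :
    1 ≤ 3 * √(k * (n - k) / n) *
      (n.choose k * ((k / n : ℝ) ^ k * (1 - k / n : ℝ) ^ (n - k))) := by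
  obtain ⟨j, rfl⟩ := Nat.exists_eq_add_of_le hkn.le
  have hj : j ≠ 0 := by lia
  have hkj : (0 : ℝ) < k + j := by positivity
  rw [Nat.add_sub_cancel_left]
  push_cast
  rw [add_sub_cancel_left, one_sub_div hkj.ne', add_sub_cancel_left, sqrt_div (by positivity),
    mul_div_assoc', div_mul_eq_mul_div, one_le_div (sqrt_pos.2 hkj)]
  exact sqrt_add_le_choose_mul hk hj

end Stirling

section Density

variable {α : Type*} [Fintype α] [DecidableEq α] {k ℓ m n : ℕ} {𝒜 ℬ : Finset (Finset α)}

lemma card_div_choose_le (hn : Fintype.card α = n) (hk : k ≠ 0) (hkn : k < n)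
    (h𝒜 : (𝒜 : Set (Finset α)).Sized k) :
    (#𝒜 / n.choose k : ℝ) ≤ 3 * √(k * (n - k) / n) * biasedWeight (k / n) univ 𝒜 := by
  rw [biasedWeight_of_sized _ (by simp) h𝒜, card_univ, hn,
    div_le_iff₀ (by exact_mod_cast Nat.choose_pos hkn.le)]
  calc (#𝒜 : ℝ) = #𝒜 * 1 := (mul_one _).symm
    _ ≤ #𝒜 * (3 * √(k * (n - k) / n) *
          (n.choose k * ((k / n : ℝ) ^ k * (1 - k / n : ℝ) ^ (n - k)))) := by
        gcongr
        exact one_le_choose_mul_pow_mul_pow hk hkn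
    _ = _ := by ring

lemma biasedWeight_mul_le_of_sized (hn : Fintype.card α = n) (hk : k ≠ 0) (hℓk : ℓ ≤ k)
    (hkm : k ≤ m) (hmkn : m + k ≤ n) (h : CrossAvoids ℓ ℓ 𝒜 ℬ) :
    biasedWeight (k / n) univ 𝒜 * biasedWeight (m / n) univ ℬ ≤
      2 * exp (-(min (ℓ : ℝ) (k - ℓ) ^ 2 / (1200 * k))) := by
  have hn0 : (0 : ℝ) < n := by exact_mod_cast (by lia : 0 < n)
  have hcard : #(univ : Finset α) * (k / n : ℝ) = k := by
    rw [card_univ, hn, mul_div_cancel₀ _ hn0.ne']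
  rify at hℓk hkm hmkn
  have := h.biasedWeight_mul_le_two_mul_exp (s := univ) (p := k / n) (q := m / n)
    (t := min (ℓ : ℝ) (k - ℓ)) (by positivity) (by rw [div_le_div_iff₀ hn0 two_pos]; linarith)
    (by gcongr) (by rw [le_sub_iff_add_le, ← add_div]; exact div_le_one_of_le₀ hmkn hn0.le)
    (le_min (by positivity) (sub_nonneg.2 hℓk)) (min_le_left _ _)
    (by rw [hcard]; exact min_le_right _ _) (by simp) (by simp)
  rwa [hcard] at this

theorem card_div_choose_mul_card_div_choose_le (hn : Fintype.card α = n) (hℓk : ℓ ≤ k)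
    (hkm : k ≤ m) (hmkn : m + k ≤ n) (h𝒜 : (𝒜 : Set (Finset α)).Sized k)
    (hℬ : (ℬ : Set (Finset α)).Sized m) (h : ∀ A ∈ 𝒜, ∀ B ∈ ℬ, #(A ∩ B) ≠ ℓ) :
    (#𝒜 / n.choose k : ℝ) * (#ℬ / n.choose m) ≤
      50 * √(k * (n - k) * m * (n - m) / n ^ 2) *
        exp (-(min (ℓ : ℝ) (k - ℓ) ^ 2 / (58 ^ 2 * k))) := by
  rcases eq_or_ne k 0 with rfl | hk
  · obtain rfl : ℓ = 0 := by lia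
    have hcard : (#𝒜 * #ℬ : ℝ) = 0 := by
      exact_mod_cast card_mul_card_eq_zero_of_sized_zero h𝒜 h
    rw [div_mul_div_comm, hcard, zero_div]
    positivity
  have hkn : (k : ℝ) ≤ n := by exact_mod_cast (by lia : k ≤ n)
  have hp1 : (k / n : ℝ) ≤ 1 := div_le_one_of_le₀ hkn n.cast_nonneg
  have hsqrt : √(k * (n - k) / n : ℝ) * √(m * (n - m) / n) =
      √(k * (n - k) * m * (n - m) / n ^ 2) := by
    rw [← sqrt_mul (div_nonneg (mul_nonneg k.cast_nonneg (sub_nonneg.2 hkn)) n.cast_nonneg)]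
    ring_nf
  calc (#𝒜 / n.choose k : ℝ) * (#ℬ / n.choose m)
      ≤ (3 * √(k * (n - k) / n) * biasedWeight (k / n) univ 𝒜) *
          (3 * √(m * (n - m) / n) * biasedWeight (m / n) univ ℬ) :=
        mul_le_mul (card_div_choose_le hn hk (by lia) h𝒜)
          (card_div_choose_le hn (by lia) (by lia) hℬ) (by positivity)
          (mul_nonneg (by positivity) (biasedWeight_nonneg (by positivity) hp1))
    _ = 9 * √(k * (n - k) * m * (n - m) / n ^ 2) *
          (biasedWeight (k / n) univ 𝒜 * biasedWeight (m / n) univ ℬ) := by rw [← hsqrt]; ring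
    _ ≤ 9 * √(k * (n - k) * m * (n - m) / n ^ 2) *
          (2 * exp (-(min (ℓ : ℝ) (k - ℓ) ^ 2 / (1200 * k)))) := by
        gcongr ?_ * ?_
        exact biasedWeight_mul_le_of_sized hn hk hℓk hkm hmkn
          (crossAvoids_self_of_card_inter_ne h)
    _ = 18 * √(k * (n - k) * m * (n - m) / n ^ 2) *
          exp (-(min (ℓ : ℝ) (k - ℓ) ^ 2 / (1200 * k))) := by ring
    _ ≤ _ := by gcongr <;> norm_num

lemma card_inter_ne_of_mem_compls (hℓk : ℓ ≤ k) (h𝒜 : (𝒜 : Set (Finset α)).Sized k)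
    (h : ∀ A ∈ 𝒜, ∀ B ∈ ℬ, #(A ∩ B) ≠ ℓ) : ∀ B ∈ ℬᶜˢ, ∀ A ∈ 𝒜, #(B ∩ A) ≠ k - ℓ := by
  intro B hB A hA hBA
  have hsplit := card_inter_add_card_sdiff A Bᶜ
  rw [h𝒜 hA, sdiff_compl, inf_eq_inter, inter_comm A B, hBA] at hsplit
  exact h A hA Bᶜ (mem_compls.1 hB) (by lia)

theorem proposition7p1_general (hn : Fintype.card α = n) (hℓk : ℓ ≤ k) (hkm : k ≤ m)
    (hmn : m ≤ n) (h𝒜 : (𝒜 : Set (Finset α)).Sized k) (hℬ : (ℬ : Set (Finset α)).Sized m)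
    (h : ∀ A ∈ 𝒜, ∀ B ∈ ℬ, #(A ∩ B) ≠ ℓ) :
    (m + k ≤ n → (#𝒜 / n.choose k : ℝ) * (#ℬ / n.choose m) ≤
      50 * √(k * (n - k) * m * (n - m) / n ^ 2) *
        exp (-(min (ℓ : ℝ) (k - ℓ) ^ 2 / (58 ^ 2 * k)))) ∧
    (n ≤ m + k → m + k ≤ n + ℓ → (#𝒜 / n.choose k : ℝ) * (#ℬ / n.choose m) ≤
      50 * √(k * (n - k) * m * (n - m) / n ^ 2) *
        exp (-(min (k - ℓ : ℝ) (n - m - (k - ℓ)) ^ 2 / (58 ^ 2 * (n - m))))) := by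
  refine ⟨fun hmkn => card_div_choose_mul_card_div_choose_le hn hℓk hkm hmkn h𝒜 hℬ h,
    fun hnmk hmkℓ => ?_⟩
  have hℬc : (ℬᶜˢ : Set (Finset α)).Sized (n - m) := hn ▸ hℬ.compls
  have hcompl := card_div_choose_mul_card_div_choose_le hn (by lia : k - ℓ ≤ n - m) (by lia)
    (by lia) hℬc h𝒜 (card_inter_ne_of_mem_compls hℓk h𝒜 h)
  rw [card_compls, Nat.choose_symm hmn, Nat.cast_sub hmn, Nat.cast_sub hℓk, mul_comm] at hcompl
  refine hcompl.trans_eq ?_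
  congr 3
  ring

end Density

theorem proposition7p1 (ℓ k m n : ℕ) (hℓ : 0 < ℓ) (hℓk : ℓ ≤ k) (hkm : k ≤ m) (hmn : m ≤ n)
    (F G : Finset (Finset (Fin n)))
    (hF : F ⊆ Finset.powersetCard k Finset.univ)
    (hG : G ⊆ Finset.powersetCard m Finset.univ)
    (hFG : Forbid n {ℓ} F G) :
    ((k : ℝ) ≤ (n : ℝ) / 2 → (m : ℝ) ≤ (n : ℝ) - k →
      ((F.card : ℝ) / (n.choose k : ℝ)) * ((G.card : ℝ) / (n.choose m : ℝ)) ≤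
        50 * Real.sqrt ((k : ℝ) * ((n : ℝ) - k) * m * ((n : ℝ) - m) / (n : ℝ) ^ 2) *
          Real.exp (-((min (ℓ : ℝ) ((k : ℝ) - ℓ)) ^ 2 / (58 ^ 2 * (k : ℝ))))) ∧
    ((k : ℝ) ≤ (n : ℝ) / 2 → (n : ℝ) - k < m → (m : ℝ) ≤ (n : ℝ) - k + ℓ →
      ((F.card : ℝ) / (n.choose k : ℝ)) * ((G.card : ℝ) / (n.choose m : ℝ)) ≤
        50 * Real.sqrt ((k : ℝ) * ((n : ℝ) - k) * m * ((n : ℝ) - m) / (n : ℝ) ^ 2) *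
          Real.exp (-((min ((k : ℝ) - ℓ) ((n : ℝ) - m - ((k : ℝ) - ℓ))) ^ 2 /
            (58 ^ 2 * ((n : ℝ) - m))))) := by
  obtain ⟨h₁, h₂⟩ := proposition7p1_general (Fintype.card_fin n) hℓk hkm hmn
    (subset_powersetCard_univ_iff.1 hF) (subset_powersetCard_univ_iff.1 hG) hFG
  exact ⟨fun _ hm => h₁ (by rify; linarith),
    fun _ hm hmℓ => h₂ (by rify; linarith) (by rify; linarith)⟩
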